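/- Let $c\in\mathbb R$ and let $\phi\in H^1_{loc}(\mathbb R)$ be real-valued, identified with its continuous representative. Call $\phi$ a (weak) traveling wave with speed $c$ of the modified Camassa--Holm (mCH) equation $$u_t-u_{xxt}=uu_{xxx}+2u_xu_{xx}-3u^2u_x$$ if there is a constant $a\in\mathbb R$ such that $$(\phi')^2+2\phi^3-2c\phi=((\phi-c)^2)''+a\qquad\text{in }\mathcal D'(\mathbb R),$$ where $\phi'$ is the weak derivative of $\phi$. Then $\phi$ is a traveling wave of mCH with speed $c$ if and only if the following three statements hold. (TW1) There are pairwise disjoint open intervals $E_i$, $i\ge 1$ (bounded or unbounded; some or all of them may be empty), and a closed set $C$ such that $\mathbb R\setminus C=\bigcup_{i\ge1}E_i$, $\phi\in C^\infty(E_i)$ for every $i$, $\phi(\xi)\ne c$ for $\xi\in\bigcup_{i\ge1}E_i$, and $\phi(\xi)=c$ for $\xi\in C$. (TW2) For these $E_i$ and $C$ there is an $a\in\mathbb R$ such that (i) for each $i\ge1$ there exists $d_i\in\mathbb R$ such that $$(\phi')^2=\frac{\phi^2\left(c-\frac{\phi^2}{2}\right)+a\phi+d_i}{c-\phi}\quad\text{on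 }E_i,\qquad\text{and } \phi\to c\text{ at every finite endpoint of }E_i;$$ (ii) if $C$ has strictly positive Lebesgue measure, then $a=2c^3-2c^2$. (TW3) $(\phi-c)^2\in W^{2,1}_{loc}(\mathbb R)$. -/

import Mathlib

open MeasureTheory Set Filter Topology
open scoped ContDiff

namespace MCH

/-- A test function on the real line: an element of `C_c^∞(ℝ)`. -/
def IsTestFunction (ψ : ℝ → ℝ) : Prop :=
  ContDiff ℝ ∞ ψ ∧ HasCompactSupport ψ

/-- `g` is a weak (distributional) derivative of `f` on `ℝ`; both are locally integrable. -/
structure HasWeakDeriv (f g : ℝ → ℝ) : Prop where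
  locallyIntegrable_left : LocallyIntegrable f volume
  locallyIntegrable_right : LocallyIntegrable g volume
  integral_eq : ∀ ψ : ℝ → ℝ, IsTestFunction ψ →
    ∫ x, f x * deriv ψ x = - ∫ x, g x * ψ x

/-- `f ∈ L²_loc(ℝ)`. -/
def MemL2Loc (f : ℝ → ℝ) : Prop :=
  ∀ K : Set ℝ, IsCompact K → MemLp f 2 (volume.restrict K)

/-- `f ∈ H¹_loc(ℝ)`: `f` and its weak derivative are in `L²_loc(ℝ)`. -/
def MemH1Loc (f : ℝ → ℝ) : Prop :=
  MemL2Loc f ∧ ∃ g : ℝ → ℝ, MemL2Loc g ∧ HasWeakDeriv f g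

/-- `f ∈ W^{2,1}_loc(ℝ)`: `f` and its first two weak derivatives are in `L¹_loc(ℝ)`. -/
def MemW21Loc (f : ℝ → ℝ) : Prop :=
  ∃ g h : ℝ → ℝ, HasWeakDeriv f g ∧ HasWeakDeriv g h

/-- `φ ∈ H¹_loc(ℝ)` is a (weak) traveling wave of the mCH equation with speed `c`: for some
constant `a`, the identity `(φ')² + 2 φ³ - 2 c φ = ((φ - c)²)'' + a` holds in the sense of
distributions. The function `g` is the weak derivative of `φ`, unique up to null sets. -/
def IsTravelingWave (c : ℝ) (φ : ℝ → ℝ) : Prop :=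
  MemH1Loc φ ∧
  ∃ a : ℝ, ∃ g : ℝ → ℝ, MemL2Loc g ∧ HasWeakDeriv φ g ∧
    ∀ ψ : ℝ → ℝ, IsTestFunction ψ →
      ∫ x, ((g x) ^ 2 + 2 * (φ x) ^ 3 - 2 * c * φ x) * ψ x =
        (∫ x, (φ x - c) ^ 2 * deriv (deriv ψ) x) + a * ∫ x, ψ x

/-- The pairwise disjoint open intervals `E i` and the closed set `C` decompose the line as
required in (TW1). The `E i` may be bounded or unbounded, and all but finitely many of them
(or all) may be empty, so that finite and empty families are covered. -/
structure TW1 (c : ℝ) (φ : ℝ → ℝ) (E : ℕ → Set ℝ) (C : Set ℝ) : Prop where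
  isOpen : ∀ i, IsOpen (E i)
  interval : ∀ i, (E i).OrdConnected
  disjoint : Pairwise fun i j => Disjoint (E i) (E j)
  isClosed : IsClosed C
  compl_eq : Cᶜ = ⋃ i, E i
  smooth : ∀ i, ContDiffOn ℝ ∞ φ (E i)
  ne_on : ∀ x ∈ ⋃ i, E i, φ x ≠ c
  eq_on : ∀ x ∈ C, φ x = c

/-- The rational function `F(v) = (v² (c - v²/2) + a v + d) / (c - v)`. -/
noncomputable def F (c a d v : ℝ) : ℝ :=
  (v ^ 2 * (c - v ^ 2 / 2) + a * v + d) / (c - v)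

/-- Condition (TW2) for the family `E i`, `C`. The finite endpoints of an interval are its
frontier points. -/
def TW2 (c : ℝ) (φ : ℝ → ℝ) (E : ℕ → Set ℝ) (C : Set ℝ) : Prop :=
  ∃ a : ℝ,
    (∀ i, ∃ d : ℝ,
      (∀ x ∈ E i, (deriv φ x) ^ 2 = F c a d (φ x)) ∧
      (∀ x ∈ frontier (E i), Tendsto φ (𝓝[E i] x) (𝓝 c))) ∧
    (0 < volume C → a = 2 * c ^ 3 - 2 * c ^ 2)

/-- Condition (TW3): `(φ - c)² ∈ W^{2,1}_loc(ℝ)`. -/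
def TW3 (c : ℝ) (φ : ℝ → ℝ) : Prop :=
  MemW21Loc fun x => (φ x - c) ^ 2

end MCH

/-! Put w = (φ - c)² and C = {φ = c}. The equation says that w'' is the function φ'² + 2φ³ - 2cφ -
a, which is locally integrable because φ' ∈ L²_loc. So (TW3) holds, and w' has an absolutely
continuous representative P. Off C, φ' = P / (2(φ - c)), so (φ, P) solves a smooth first-order
system. Bootstrapping gives smoothness (`contDiffOn_of_system`), and an energy is conserved on each
interval (`exists_first_integral`). On C, φ' = 0 a.e., since it is a level set. Also P = 0 there
because w is minimal, hence w'' = 0 a.e. (`ae_eq_zero_of_eq_const`). The equation reduces to a = 2c³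
- 2c², a condition only if C has positive measure. Conversely, differentiating the energy relation
gives back the equation off C, except for constant solutions (`second_order_or_const`). By (TW3),
w'' has no singular part on C, so the a.e. identity is the distributional one
(`isTravelingWave_of_second_order`). -/

namespace MCH

/-! ### Primitives of locally integrable functions. -/

/-- `f` is an indefinite integral of the locally integrable function `g`. -/
structure IsPrimitive (f g : ℝ → ℝ) : Prop where
  locallyIntegrable : LocallyIntegrable g volume
  integral_eq_sub : ∀ x y : ℝ, ∫ t in x..y, g t = f y - f x

theorem _root_.MeasureTheory.LocallyIntegrable.intervalIntegrable' {g : ℝ → ℝ}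
    (hg : LocallyIntegrable g volume) (x y : ℝ) : IntervalIntegrable g volume x y :=
  intervalIntegrable_iff.mpr <|
    (hg.integrableOn_isCompact isCompact_uIcc).mono_set uIoc_subset_uIcc

theorem isPrimitive_add_integral {g : ℝ → ℝ} (hg : LocallyIntegrable g volume) (k : ℝ) :
    IsPrimitive (fun x => k + ∫ t in (0 : ℝ)..x, g t) g where
  locallyIntegrable := hg
  integral_eq_sub x y := by
    rw [add_sub_add_left_eq_sub, intervalIntegral.integral_interval_sub_left] <;>
    exact hg.intervalIntegrable' _ _

namespace IsPrimitive

variable {f g : ℝ → ℝ}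

theorem eq_add_integral (h : IsPrimitive f g) (a : ℝ) :
    f = fun x => f a + ∫ t in a..x, g t := by
  funext x
  rw [h.integral_eq_sub]
  ring

theorem absolutelyContinuousOnInterval (h : IsPrimitive f g) (a b : ℝ) :
    AbsolutelyContinuousOnInterval f a b := by
  have h1 := (h.locallyIntegrable.intervalIntegrable' a
    b).absolutelyContinuousOnInterval_intervalIntegral (c := a) (by simp)
  have h2 : AbsolutelyContinuousOnInterval (fun _ : ℝ => f a) a b :=
    contDiffOn_const.absolutelyContinuousOnInterval
  rw [h.eq_add_integral a]
  exact h2.add h1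

theorem continuous (h : IsPrimitive f g) : Continuous f := by
  rw [h.eq_add_integral 0]
  exact continuous_const.add
    (intervalIntegral.continuous_primitive (fun a b => h.locallyIntegrable.intervalIntegrable' a b) 0)

theorem ae_hasDerivAt (h : IsPrimitive f g) : ∀ᵐ x, HasDerivAt f (g x) x := by
  filter_upwards [LocallyIntegrable.ae_hasDerivAt_integral h.locallyIntegrable] with x hx
  rw [h.eq_add_integral 0]
  exact (hx 0).const_add (f 0)

theorem hasWeakDeriv (h : IsPrimitive f g) : HasWeakDeriv f g where
  locallyIntegrable_left := h.continuous.locallyIntegrable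
  locallyIntegrable_right := h.locallyIntegrable
  integral_eq ψ hψ := by
    obtain ⟨R, hR⟩ := hψ.2.isCompact.isBounded.subset_ball (0 : ℝ)
    rw [Real.ball_eq_Ioo, zero_sub, zero_add] at hR
    have hs : Function.support ψ ⊆ Ioo (-R) R := (subset_tsupport ψ).trans hR
    have hs' : Function.support (deriv ψ) ⊆ Ioo (-R) R := support_deriv_subset.trans hR
    have hψ1 : AbsolutelyContinuousOnInterval ψ (-R) R :=
      (hψ.1.of_le (by simp)).contDiffOn.absolutelyContinuousOnInterval
    have key := (h.absolutelyContinuousOnInterval (-R) R).integral_mul_deriv_eq_deriv_mul hψ1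
    have e1 : ψ R = 0 := Function.notMem_support.1 fun hx => (hs hx).2.false
    have e2 : ψ (-R) = 0 := Function.notMem_support.1 fun hx => (hs hx).1.false
    have e3 : ∫ x in (-R)..R, deriv f x * ψ x = ∫ x in (-R)..R, g x * ψ x := by
      apply intervalIntegral.integral_congr_ae
      filter_upwards [h.ae_hasDerivAt] with x hx _
      rw [hx.deriv]
    rw [e1, e2, e3, intervalIntegral.integral_eq_integral_of_support_subset,
      intervalIntegral.integral_eq_integral_of_support_subset] at key
    · rw [key]; ring
    · exact (Function.support_mul_subset_right _ _).trans (hs.trans Ioo_subset_Ioc_self)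
    · exact (Function.support_mul_subset_right _ _).trans (hs'.trans Ioo_subset_Ioc_self)

theorem sq_sub_const (h : IsPrimitive f g) (c : ℝ) :
    IsPrimitive (fun x => (f x - c) ^ 2) (fun x => 2 * (f x - c) * g x) where
  locallyIntegrable := by
    have hc : Continuous fun x => 2 * (f x - c) :=
      continuous_const.mul (h.continuous.sub continuous_const)
    rw [locallyIntegrable_iff]
    intro K hK
    exact (h.locallyIntegrable.integrableOn_isCompact hK).continuousOn_mul hc.continuousOn hK
  integral_eq_sub x y := by
    have hc : AbsolutelyContinuousOnInterval (fun _ : ℝ => c) x y :=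
      contDiffOn_const.absolutelyContinuousOnInterval
    have h1 := (h.absolutelyContinuousOnInterval x y).fun_sub hc
    have h2 := (h1.fun_mul h1).integral_deriv_eq_sub
    simp only [← sq] at h2
    rw [← h2]
    apply intervalIntegral.integral_congr_ae
    filter_upwards [h.ae_hasDerivAt] with t ht _
    have := ((ht.sub_const c).fun_pow 2).deriv
    rw [this]
    simp

theorem congr_right {k : ℝ → ℝ} (h : IsPrimitive f g) (hgk : g =ᵐ[volume] k) :
    IsPrimitive f k where
  locallyIntegrable := h.locallyIntegrable.congr hgk
  integral_eq_sub x y := by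
    rw [← h.integral_eq_sub]
    apply intervalIntegral.integral_congr_ae
    filter_upwards [hgk] with t ht _ using ht.symm

/-- A primitive of `g` is differentiable wherever `g` agrees almost everywhere, on a
neighbourhood, with a continuous function. -/
theorem hasDerivAt_of_ae_eq (h : IsPrimitive f g) {U : Set ℝ} (hU : IsOpen U) {k : ℝ → ℝ}
    (hk : ContinuousOn k U) (hgk : ∀ᵐ x, x ∈ U → g x = k x) {x : ℝ} (hx : x ∈ U) :
    HasDerivAt f (k x) x := by
  obtain ⟨ε, hε, hball⟩ := Metric.isOpen_iff.1 hU x hx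
  have hkd : HasDerivAt (fun y => f x + ∫ t in x..y, k t) (k x) x := by
    refine (intervalIntegral.integral_hasDerivAt_right (by simp) ?_ ?_).const_add (f x)
    · exact (hk.stronglyMeasurableAtFilter hU) x hx
    · exact hk.continuousAt (hU.mem_nhds hx)
  refine hkd.congr_of_eventuallyEq ?_
  filter_upwards [Metric.ball_mem_nhds x hε] with y hy
  have : ∫ t in x..y, k t = ∫ t in x..y, g t := by
    apply intervalIntegral.integral_congr_ae
    filter_upwards [hgk] with t ht htm
    refine (ht (hball ?_)).symm
    exact (convex_ball x ε).ordConnected.uIcc_subset (Metric.mem_ball_self hε) hy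
      (uIoc_subset_uIcc htm)
  rw [this, h.integral_eq_sub]
  ring

/-- The derivative vanishes almost everywhere on each level set. -/
theorem ae_eq_zero_of_eqOn_const (h : IsPrimitive f g) {C : Set ℝ} {c : ℝ}
    (hC : ∀ x ∈ C, f x = c) : ∀ᵐ x, x ∈ C → g x = 0 := by
  -- Points of C isolated from the right in C are countably many. At any other point of C, the
  -- derivative of `f` is determined by its values on C, where `f` is constant.
  have hn : volume {x ∈ C | 𝓝[C ∩ Ioi x] x = ⊥} = 0 :=
    countable_setOfPred_isolated_right_within.measure_zero volume
  filter_upwards [h.ae_hasDerivAt, measure_eq_zero_iff_ae_notMem.1 hn] with x hx hxn hxC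
  have hne : 𝓝[C ∩ Ioi x] x ≠ ⊥ := fun hb => hxn ⟨hxC, hb⟩
  have hacc : AccPt x (𝓟 (C ∩ Ioi x)) := by
    have hs : (C ∩ Ioi x) \ {x} = C ∩ Ioi x := sdiff_singleton_eq_self fun hm => lt_irrefl x hm.2
    rw [accPt_principal_iff_nhdsWithin, hs]
    exact ⟨hne⟩
  have hu : UniqueDiffWithinAt ℝ (C ∩ Ioi x) x := uniqueDiffWithinAt_iff_accPt.2 hacc
  have h0 : HasDerivWithinAt f 0 (C ∩ Ioi x) x :=
    (hasDerivWithinAt_const x (C ∩ Ioi x) c).congr (fun y hy => hC y hy.1) (hC x hxC)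
  exact hu.eq_deriv _ hx.hasDerivWithinAt h0

end IsPrimitive

/-! ### From weak derivatives to primitives. -/

/-- A locally integrable function with vanishing distributional derivative is constant. -/
theorem exists_ae_eq_const {u : ℝ → ℝ} (hu : LocallyIntegrable u volume)
    (h : ∀ ψ : ℝ → ℝ, IsTestFunction ψ → ∫ x, u x * deriv ψ x = 0) :
    ∃ k : ℝ, ∀ᵐ x, u x = k := by
  let b : ContDiffBump (0 : ℝ) := default
  let ρ : ℝ → ℝ := b.normed volume
  have hρ : IsTestFunction ρ := ⟨b.contDiff_normed, b.hasCompactSupport_normed⟩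
  have hρi : Integrable ρ := hρ.1.continuous.integrable_of_hasCompactSupport hρ.2
  have hρ1 : ∫ x, ρ x = 1 := b.integral_normed
  have hint : ∀ χ : ℝ → ℝ, IsTestFunction χ → Integrable (fun x => u x * χ x) := fun χ hχ => by
    simpa [mul_comm] using hu.integrable_smul_left_of_hasCompactSupport hχ.1.continuous hχ.2
  refine ⟨∫ x, u x * ρ x, ?_⟩
  set k := ∫ x, u x * ρ x
  have key : ∀ᵐ x, u x - k = 0 := by
    refine ae_eq_zero_of_integral_contDiff_smul_eq_zero
      (hu.sub (locallyIntegrable_const k)) fun χ hχ hχc => ?_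
    have hχi : Integrable χ := hχ.continuous.integrable_of_hasCompactSupport hχc
    set m := ∫ x, χ x
    -- Subtracting `m * ρ` makes the mean zero, so `η` is the derivative of a test function and `u`
    -- annihilates it.
    let η : ℝ → ℝ := fun x => χ x - m * ρ x
    have hη : ContDiff ℝ ∞ η := hχ.sub (contDiff_const.mul hρ.1)
    have hηc : HasCompactSupport η := hχc.sub (hρ.2.mul_left)
    have hηi : ∫ x, η x = 0 := by
      simp only [η]
      rw [integral_sub hχi (hρi.const_mul m), integral_const_mul, hρ1]
      simp [m]
    obtain ⟨R, hR⟩ := hηc.isCompact.isBounded.subset_ball (0 : ℝ)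
    rw [Real.ball_eq_Ioo, zero_sub, zero_add] at hR
    have hs : Function.support η ⊆ Ioo (-R) R := (subset_tsupport η).trans hR
    let ψ : ℝ → ℝ := fun x => ∫ t in (-R)..x, η t
    have hψd : ∀ x, HasDerivAt ψ (η x) x := fun x =>
      hη.continuous.integral_hasStrictDerivAt (-R) x |>.hasDerivAt
    have hψ' : deriv ψ = η := funext fun x => (hψd x).deriv
    have hψ : ContDiff ℝ ∞ ψ :=
      contDiff_infty_iff_deriv.2 ⟨fun x => (hψd x).differentiableAt, hψ' ▸ hη⟩
    have hψc : HasCompactSupport ψ := by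
      refine HasCompactSupport.intro (isCompact_Icc (a := -R) (b := R)) fun x hx => ?_
      rcases lt_or_ge x (-R) with hxR | hxR
      · refine intervalIntegral.integral_zero_ae (Eventually.of_forall fun t ht => ?_)
        rw [uIoc_of_ge hxR.le] at ht
        exact Function.notMem_support.1 fun hm => (ht.2.trans_lt (hs hm).1).false
      · have hRx : R < x := by
          by_contra hcon
          exact hx ⟨hxR, not_lt.1 hcon⟩
        change ∫ t in (-R)..x, η t = 0
        rw [intervalIntegral.integral_eq_integral_of_support_subset, hηi]
        exact hs.trans fun t ht => ⟨ht.1, (ht.2.trans hRx).le⟩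
    have h0 := h ψ ⟨hψ, hψc⟩
    rw [hψ'] at h0
    have e1 : ∫ x, u x * η x = (∫ x, u x * χ x) - m * k := by
      have : ∀ x, u x * η x = u x * χ x - m * (u x * ρ x) := fun x => by simp only [η]; ring
      simp only [this]
      rw [integral_sub (hint χ ⟨hχ, hχc⟩) ((hint ρ hρ).const_mul m), integral_const_mul]
    have e2 : ∫ x, χ x • (u x - k) = (∫ x, u x * χ x) - k * m := by
      have : ∀ x, χ x • (u x - k) = u x * χ x - k * χ x := fun x => by
        rw [smul_eq_mul]; ring
      simp only [this]
      rw [integral_sub (hint χ ⟨hχ, hχc⟩) (hχi.const_mul k), integral_const_mul]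
    linarith
  filter_upwards [key] with x hx using sub_eq_zero.1 hx

namespace HasWeakDeriv

variable {f g : ℝ → ℝ}

theorem congr {f' g' : ℝ → ℝ} (h : HasWeakDeriv f g) (hf : f =ᵐ[volume] f')
    (hg : g =ᵐ[volume] g') : HasWeakDeriv f' g' where
  locallyIntegrable_left := h.locallyIntegrable_left.congr hf
  locallyIntegrable_right := h.locallyIntegrable_right.congr hg
  integral_eq ψ hψ := by
    have e1 : ∫ x, f' x * deriv ψ x = ∫ x, f x * deriv ψ x :=
      integral_congr_ae (by filter_upwards [hf] with x hx; rw [hx])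
    have e2 : ∫ x, g' x * ψ x = ∫ x, g x * ψ x :=
      integral_congr_ae (by filter_upwards [hg] with x hx; rw [hx])
    rw [e1, e2, h.integral_eq ψ hψ]

theorem exists_isPrimitive (h : HasWeakDeriv f g) :
    ∃ P : ℝ → ℝ, f =ᵐ[volume] P ∧ IsPrimitive P g := by
  have hG := isPrimitive_add_integral h.locallyIntegrable_right 0
  set G : ℝ → ℝ := fun x => 0 + ∫ t in (0 : ℝ)..x, g t
  have hint : ∀ {u : ℝ → ℝ}, LocallyIntegrable u volume → ∀ χ : ℝ → ℝ, IsTestFunction χ →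
      Integrable (fun x => u x * deriv χ x) := fun hu χ hχ => by
    simpa [mul_comm] using hu.integrable_smul_left_of_hasCompactSupport
      (hχ.1.continuous_deriv (by simp)) hχ.2.deriv
  obtain ⟨k, hk⟩ := exists_ae_eq_const
    (h.locallyIntegrable_left.sub hG.continuous.locallyIntegrable) fun ψ hψ => by
      simp only [Pi.sub_apply, sub_mul]
      rw [integral_sub (hint h.locallyIntegrable_left ψ hψ)
        (hint hG.continuous.locallyIntegrable ψ hψ), h.integral_eq ψ hψ,
        hG.hasWeakDeriv.integral_eq ψ hψ, sub_self]
  refine ⟨_, ?_, isPrimitive_add_integral h.locallyIntegrable_right k⟩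
  filter_upwards [hk] with x hx
  simp only [Pi.sub_apply, G] at hx
  linarith

theorem isPrimitive (h : HasWeakDeriv f g) (hf : Continuous f) : IsPrimitive f g := by
  obtain ⟨P, hP, hPg⟩ := h.exists_isPrimitive
  rwa [← (hf.ae_eq_iff_eq volume hPg.continuous).1 hP] at hPg

end HasWeakDeriv

/-! ### Decomposition of an open set into intervals. -/

/-- An open subset of the line is a countable union of pairwise disjoint open intervals. -/
theorem exists_disjoint_intervals {U : Set ℝ} (hU : IsOpen U) :
    ∃ E : ℕ → Set ℝ, (∀ i, IsOpen (E i)) ∧ (∀ i, (E i).OrdConnected) ∧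
      (Pairwise fun i j => Disjoint (E i) (E j)) ∧ U = ⋃ i, E i := by
  let S : Set (Set ℝ) := (fun x => connectedComponentIn U x) '' U
  have hSo : ∀ s ∈ S, IsOpen s := by
    rintro _ ⟨x, -, rfl⟩
    exact hU.connectedComponentIn
  have hSc : ∀ s ∈ S, s.OrdConnected := by
    rintro _ ⟨x, -, rfl⟩
    exact isPreconnected_connectedComponentIn.ordConnected
  have hSn : ∀ s ∈ S, s.Nonempty := by
    rintro _ ⟨x, hx, rfl⟩
    exact ⟨x, mem_connectedComponentIn hx⟩
  have hSd : S.PairwiseDisjoint id := by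
    rintro _ ⟨x, hx, rfl⟩ _ ⟨y, hy, rfl⟩ hne
    by_contra hnd
    obtain ⟨z, hzx, hzy⟩ := not_disjoint_iff.1 hnd
    exact hne ((connectedComponentIn_eq hzx).trans (connectedComponentIn_eq hzy).symm)
  have hcount : S.Countable := hSd.countable_of_isOpen hSo hSn
  have := hcount.toEncodable
  -- Indices that encode no component receive the empty set.
  refine ⟨fun i => ⋃ b ∈ Encodable.decode₂ S i, (b : Set ℝ), fun i => ?_, fun i => ?_, ?_, ?_⟩
  · exact Encodable.iUnion_decode₂_cases (f := fun b : S => (b : Set ℝ)) (C := IsOpen)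
      isOpen_empty fun b => hSo b b.2
  · exact Encodable.iUnion_decode₂_cases (f := fun b : S => (b : Set ℝ)) (C := OrdConnected)
      ordConnected_empty fun b => hSc b b.2
  · exact Encodable.iUnion_decode₂_disjoint_on fun s t hst =>
      hSd s.2 t.2 (Subtype.coe_injective.ne hst)
  · rw [Encodable.iUnion_decode₂]
    ext x
    rw [mem_iUnion]
    constructor
    · exact fun hx => ⟨⟨_, x, hx, rfl⟩, mem_connectedComponentIn hx⟩
    · rintro ⟨⟨_, y, _, rfl⟩, hxy⟩
      exact connectedComponentIn_subset U y hxy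

theorem frontier_subset_of_compl_eq_iUnion {E : ℕ → Set ℝ} {C : Set ℝ} (ho : ∀ i, IsOpen (E i))
    (hd : Pairwise fun i j => Disjoint (E i) (E j)) (hC : Cᶜ = ⋃ i, E i) (i : ℕ) :
    frontier (E i) ⊆ C := by
  intro x hx
  by_contra hxC
  obtain ⟨j, hj⟩ := mem_iUnion.1 (hC ▸ hxC : x ∈ ⋃ i, E i)
  rw [(ho i).frontier_eq] at hx
  rcases eq_or_ne i j with rfl | hij
  · exact hx.2 hj
  · exact ((hd hij).closure_left (ho j)).le_bot ⟨hx.1, hj⟩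

/-! ### The differential equation where φ ≠ c. -/

/-- Both right-hand sides are smooth in (φ, P) while φ ≠ c, so if φ and P are both C^n, they are
both C^(n+1). -/
theorem contDiffOn_of_system {c a : ℝ} {φ P : ℝ → ℝ} {U : Set ℝ} (hU : IsOpen U)
    (hne : ∀ x ∈ U, φ x ≠ c) (hφ : ∀ x ∈ U, HasDerivAt φ (P x / (2 * (φ x - c))) x)
    (hP : ∀ x ∈ U,
      HasDerivAt P ((P x / (2 * (φ x - c))) ^ 2 + 2 * φ x ^ 3 - 2 * c * φ x - a) x) :
    ContDiffOn ℝ ∞ φ U := by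
  suffices H : ∀ n : ℕ, ContDiffOn ℝ n φ U ∧ ContDiffOn ℝ n P U from
    contDiffOn_infty.2 fun n => (H n).1
  intro n
  induction n with
  | zero =>
    simp only [Nat.cast_zero, contDiffOn_zero]
    exact ⟨fun x hx => (hφ x hx).continuousAt.continuousWithinAt,
      fun x hx => (hP x hx).continuousAt.continuousWithinAt⟩
  | succ n ih =>
    have hQ : ContDiffOn ℝ n (fun x => P x / (2 * (φ x - c))) U :=
      ih.2.div (contDiffOn_const.mul (ih.1.sub contDiffOn_const)) fun x hx =>
        mul_ne_zero two_ne_zero (sub_ne_zero.2 (hne x hx))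
    have hR : ContDiffOn ℝ n
        (fun x => (P x / (2 * (φ x - c))) ^ 2 + 2 * φ x ^ 3 - 2 * c * φ x - a) U :=
      (((hQ.pow 2).add (contDiffOn_const.mul (ih.1.pow 3))).sub
        (contDiffOn_const.mul ih.1)).sub contDiffOn_const
    rw [Nat.cast_succ, contDiffOn_succ_iff_deriv_of_isOpen hU,
      contDiffOn_succ_iff_deriv_of_isOpen hU]
    refine ⟨⟨fun x hx => (hφ x hx).differentiableAt.differentiableWithinAt, by simp,
      hQ.congr fun x hx => (hφ x hx).deriv⟩,
      ⟨fun x hx => (hP x hx).differentiableAt.differentiableWithinAt, by simp,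
      hR.congr fun x hx => (hP x hx).deriv⟩⟩

theorem exists_first_integral {c a : ℝ} {φ P : ℝ → ℝ} {E : Set ℝ} (hE : IsOpen E)
    (hEc : E.OrdConnected) (hne : ∀ x ∈ E, φ x ≠ c)
    (hφ : ∀ x ∈ E, HasDerivAt φ (P x / (2 * (φ x - c))) x)
    (hP : ∀ x ∈ E,
      HasDerivAt P ((P x / (2 * (φ x - c))) ^ 2 + 2 * φ x ^ 3 - 2 * c * φ x - a) x) :
    ∃ d : ℝ, ∀ x ∈ E, deriv φ x ^ 2 = F c a d (φ x) := by
  -- The first term is (c - φ)φ'² with φ' expressed through P, so K is the value of `d` in the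
  -- first-order equation.
  let K : ℝ → ℝ := fun x =>
    P x ^ 2 / (4 * (c - φ x)) - (φ x ^ 2 * (c - φ x ^ 2 / 2) + a * φ x)
  have hK : ∀ x ∈ E, HasDerivAt K 0 x := by
    intro x hx
    have h1 : φ x - c ≠ 0 := sub_ne_zero.2 (hne x hx)
    have h2 : c - φ x ≠ 0 := sub_ne_zero.2 (hne x hx).symm
    have := (((hP x hx).fun_pow 2).fun_div (((hφ x hx).const_sub c).const_mul 4)
      (mul_ne_zero four_ne_zero h2)).fun_sub
      ((((hφ x hx).fun_pow 2).fun_mul ((((hφ x hx).fun_pow 2).div_const 2).const_sub c)).fun_add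
        ((hφ x hx).const_mul a))
    refine this.congr_deriv ?_
    have h3 : c - φ x = -(φ x - c) := by ring
    rw [h3]
    obtain ⟨v, hv⟩ : ∃ v, v = φ x - c := ⟨_, rfl⟩
    have h4 : φ x = v + c := by rw [hv]; ring
    rw [← hv] at h1 ⊢
    rw [h4]
    field_simp
    push_cast
    ring
  obtain ⟨d, hd⟩ := hE.exists_is_const_of_deriv_eq_zero hEc.isPreconnected
    (fun x hx => (hK x hx).differentiableAt.differentiableWithinAt) fun x hx => (hK x hx).deriv
  refine ⟨d, fun x hx => ?_⟩
  have h1 : φ x - c ≠ 0 := sub_ne_zero.2 (hne x hx)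
  have h2 : c - φ x ≠ 0 := sub_ne_zero.2 (hne x hx).symm
  have h5 : K x = d := hd x hx
  rw [(hφ x hx).deriv, F, ← h5, add_sub_cancel]
  have h3 : c - φ x = -(φ x - c) := by ring
  rw [h3]
  field_simp
  ring

/-- On an interval, a solution of the first-order equation is constant or satisfies the
second-order equation obtained by differentiation. -/
theorem second_order_or_const {c a d : ℝ} {φ : ℝ → ℝ} {E : Set ℝ} (hE : IsOpen E)
    (hEc : E.OrdConnected) (hφ : ContDiffOn ℝ ∞ φ E) (hne : ∀ x ∈ E, φ x ≠ c)
    (hode : ∀ x ∈ E, deriv φ x ^ 2 = F c a d (φ x)) :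
    (∀ x ∈ E, 2 * deriv (deriv φ) x * (φ x - c) + deriv φ x ^ 2 =
      2 * φ x ^ 3 - 2 * c * φ x - a) ∨ ∃ v, ∀ x ∈ E, φ x = v := by
  have hφ1 : ContDiffOn ℝ ∞ (deriv φ) E := hφ.deriv_of_isOpen hE (by simp)
  have hφ2 : ContDiffOn ℝ ∞ (deriv (deriv φ)) E := hφ1.deriv_of_isOpen hE (by simp)
  have hd0 : ∀ x ∈ E, HasDerivAt φ (deriv φ x) x := fun x hx =>
    ((hφ.differentiableOn (by simp)).differentiableAt (hE.mem_nhds hx)).hasDerivAt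
  have hd1 : ∀ x ∈ E, HasDerivAt (deriv φ) (deriv (deriv φ) x) x := fun x hx =>
    ((hφ1.differentiableOn (by simp)).differentiableAt (hE.mem_nhds hx)).hasDerivAt
  -- Z is the residual of the second-order equation as a function of the 2-jet T. Differentiating
  -- the first-order equation yields only φ' · Z(T) = 0.
  let Z : ℝ × ℝ × ℝ → ℝ := fun t => 2 * t.2.2 * (t.1 - c) + t.2.1 ^ 2 -
    (2 * t.1 ^ 3 - 2 * c * t.1 - a)
  let T : ℝ → ℝ × ℝ × ℝ := fun x => (φ x, deriv φ x, deriv (deriv φ) x)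
  have hT : ContinuousOn T E :=
    hφ.continuousOn.prodMk (hφ1.continuousOn.prodMk hφ2.continuousOn)
  have hZ : Continuous Z := by fun_prop
  have hZ0 : ∀ x ∈ E, deriv φ x * Z (T x) = 0 := by
    intro x hx
    have h1 := (((hd1 x hx).fun_pow 2).fun_mul ((hd0 x hx).const_sub c)).fun_sub
      ((((hd0 x hx).fun_pow 2).fun_mul ((((hd0 x hx).fun_pow 2).div_const 2).const_sub c)).fun_add
        ((hd0 x hx).const_mul a))
    have h2 : HasDerivAt (fun _ : ℝ => d) 0 x := hasDerivAt_const x d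
    have h3 := h1.unique (h2.congr_of_eventuallyEq (by
      filter_upwards [hE.mem_nhds hx] with y hy
      rw [hode y hy, F, div_mul_cancel₀ _ (sub_ne_zero.2 (hne y hy).symm)]
      ring))
    simp only [Z, T]
    push_cast at h3
    linear_combination -h3
  by_cases hcase : ∀ x ∈ E, Z (T x) = 0
  · exact Or.inl fun x hx => sub_eq_zero.1 (hcase x hx)
  right
  push Not at hcase
  obtain ⟨x₀, hx₀, hZx₀⟩ := hcase
  have hloc : ∀ x ∈ E, Z (T x) ≠ 0 → ∀ᶠ y in 𝓝 x, T y = (φ x, 0, 0) := by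
    intro x hx hZx
    have h1 : ∀ᶠ y in 𝓝 x, deriv φ y = 0 := by
      have hc : ContinuousAt (fun y => Z (T y)) x :=
        hZ.continuousAt.comp (hT.continuousAt (hE.mem_nhds hx))
      filter_upwards [hc.eventually_ne hZx, hE.mem_nhds hx] with y hy hyE
      exact (mul_eq_zero.1 (hZ0 y hyE)).resolve_right hy
    have h2 : ∀ᶠ y in 𝓝 x, deriv (deriv φ) y = 0 := by
      filter_upwards [h1.eventually_nhds] with y hy
      have : deriv φ =ᶠ[𝓝 y] fun _ => 0 := hy
      rw [this.deriv_eq, deriv_const]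
    have h3 : ∀ᶠ y in 𝓝 x, φ y = φ x := by
      obtain ⟨ε, hε, hb⟩ := Metric.eventually_nhds_iff_ball.1 (h1.and (hE.mem_nhds hx))
      filter_upwards [Metric.ball_mem_nhds x hε] with y hy
      exact Metric.isOpen_ball.is_const_of_deriv_eq_zero (convex_ball x ε).isPreconnected
        (fun z hz => (hd0 z (hb z hz).2).differentiableAt.differentiableWithinAt)
        (fun z hz => (hb z hz).1) hy (Metric.mem_ball_self hε)
    filter_upwards [h1, h2, h3] with y e1 e2 e3
    simp only [T, e1, e2, e3]
  have hTx₀ : T x₀ = (φ x₀, 0, 0) := (hloc x₀ hx₀ hZx₀).self_of_nhds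
  -- The set where T takes its value at x₀ is relatively closed. It is also open: Z(T) is the same
  -- nonzero number at all its points, so T is locally constant there. Connectedness of E concludes.
  have hsub : E ⊆ E ∩ T ⁻¹' {(φ x₀, 0, 0)} := by
    refine hEc.isPreconnected.subset_left_of_subset_union (v := E ∩ T ⁻¹' {(φ x₀, 0, 0)}ᶜ)
      ?_ (hT.isOpen_inter_preimage hE isOpen_compl_singleton) ?_ ?_ ⟨x₀, hx₀, hx₀, hTx₀⟩
    · rw [isOpen_iff_mem_nhds]
      rintro x ⟨hx, hTx⟩
      rw [mem_preimage, mem_singleton_iff] at hTx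
      have hφx : φ x = φ x₀ := congrArg Prod.fst hTx
      filter_upwards [hE.mem_nhds hx, hloc x hx (by rwa [hTx, ← hTx₀])] with y hy hTy
      exact ⟨hy, by rw [mem_preimage, hTy, hφx, mem_singleton_iff]⟩
    · exact disjoint_left.2 fun x hx hx' => hx'.2 hx.2
    · intro x hx
      by_cases h : T x = (φ x₀, 0, 0)
      · exact Or.inl ⟨hx, h⟩
      · exact Or.inr ⟨hx, h⟩
  exact ⟨φ x₀, fun x hx => congrArg Prod.fst (hsub hx).2⟩

/-! ### Behaviour on C and the two implications. -/

theorem IsTestFunction.deriv {ψ : ℝ → ℝ} (h : IsTestFunction ψ) : IsTestFunction (deriv ψ) :=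
  ⟨(contDiff_infty_iff_deriv.1 h.1).2, HasCompactSupport.deriv h.2⟩

theorem _root_.MeasureTheory.LocallyIntegrable.integrable_mul_isTestFunction {u ψ : ℝ → ℝ}
    (hu : LocallyIntegrable u volume) (hψ : IsTestFunction ψ) :
    Integrable (fun x => u x * ψ x) := by
  simpa [mul_comm] using hu.integrable_smul_left_of_hasCompactSupport hψ.1.continuous hψ.2

theorem IsTestFunction.integrable {ψ : ℝ → ℝ} (h : IsTestFunction ψ) : Integrable ψ :=
  h.1.continuous.integrable_of_hasCompactSupport h.2

theorem MemL2Loc.locallyIntegrable_sq {g : ℝ → ℝ} (hg : MemL2Loc g) :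
    LocallyIntegrable (fun x => g x ^ 2) volume :=
  locallyIntegrable_iff.2 fun K hK => (hg K hK).integrable_sq

/-- If `(φ - c)²` is a primitive of a primitive of `h`, then `h` vanishes almost everywhere
on `{φ = c}`. -/
theorem ae_eq_zero_of_eq_const {c : ℝ} {φ P h : ℝ → ℝ}
    (hw : IsPrimitive (fun x => (φ x - c) ^ 2) P) (hP : IsPrimitive P h) {C : Set ℝ}
    (hC : ∀ x ∈ C, φ x = c) : ∀ᵐ x, x ∈ C → h x = 0 := by
  -- Every point of C minimises (φ - c)², whose classical derivative is the continuous P. So C lies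
  -- in a level set of P.
  refine hP.ae_eq_zero_of_eqOn_const (c := 0) fun x hx => ?_
  have hd : HasDerivAt (fun x => (φ x - c) ^ 2) (P x) x :=
    hw.hasDerivAt_of_ae_eq isOpen_univ hP.continuous.continuousOn
      (Eventually.of_forall fun _ _ => rfl) (mem_univ x)
  refine IsLocalMin.hasDerivAt_eq_zero (Eventually.of_forall fun y => ?_) hd
  simpa [hC x hx] using sq_nonneg (φ y - c)

theorem isTravelingWave_of_second_order {c a : ℝ} {φ : ℝ → ℝ} (hφ : MemH1Loc φ)
    (hcont : Continuous φ) {C : Set ℝ} (hC : IsClosed C) (hφC : ∀ x ∈ C, φ x = c)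
    (hsmooth : ContDiffOn ℝ ∞ φ Cᶜ)
    (hode : ∀ x ∈ Cᶜ, 2 * deriv (deriv φ) x * (φ x - c) + deriv φ x ^ 2 =
      2 * φ x ^ 3 - 2 * c * φ x - a)
    (ha : 0 < volume C → a = 2 * c ^ 3 - 2 * c ^ 2) (hw : TW3 c φ) :
    IsTravelingWave c φ := by
  obtain ⟨-, g, hg2, hg⟩ := id hφ
  obtain ⟨p, h, hwp, hph⟩ := hw
  obtain ⟨P, hpP, hP⟩ := hph.exists_isPrimitive
  have hgp := hg.isPrimitive hcont
  have hwP : IsPrimitive (fun x => (φ x - c) ^ 2) P :=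
    (hwp.isPrimitive ((hcont.sub continuous_const).pow 2)).congr_right hpP
  have hU : IsOpen Cᶜ := hC.isOpen_compl
  have hd0 : ∀ x ∈ Cᶜ, HasDerivAt φ (deriv φ x) x := fun x hx =>
    ((hsmooth.differentiableOn (by simp)).differentiableAt (hU.mem_nhds hx)).hasDerivAt
  have hd1 : ∀ x ∈ Cᶜ, HasDerivAt (deriv φ) (deriv (deriv φ) x) x := fun x hx =>
    (((hsmooth.deriv_of_isOpen (m := ∞) hU (by simp)).differentiableOn
      (by simp)).differentiableAt (hU.mem_nhds hx)).hasDerivAt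
  have hPU : ∀ x ∈ Cᶜ, P x = 2 * (φ x - c) * deriv φ x := fun x hx => by
    have h1 : HasDerivAt (fun x => (φ x - c) ^ 2) (P x) x :=
      hwP.hasDerivAt_of_ae_eq isOpen_univ hP.continuous.continuousOn
        (Eventually.of_forall fun _ _ => rfl) (mem_univ x)
    simpa using h1.unique (((hd0 x hx).sub_const c).fun_pow 2)
  -- Off C this is the classical equation. On C both `g` and `h` vanish a.e., leaving 2c³ - 2c² = a.
  have hmain : ∀ᵐ x, g x ^ 2 + 2 * φ x ^ 3 - 2 * c * φ x = h x + a := by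
    have hvol : ∀ᵐ x, x ∈ C → a = 2 * c ^ 3 - 2 * c ^ 2 := by
      rcases eq_or_ne (volume C) 0 with h0 | h0
      · filter_upwards [measure_eq_zero_iff_ae_notMem.1 h0] with x hx hxC using absurd hxC hx
      · exact Eventually.of_forall fun x _ => ha (pos_iff_ne_zero.2 h0)
    filter_upwards [hgp.ae_hasDerivAt, hP.ae_hasDerivAt, hgp.ae_eq_zero_of_eqOn_const hφC,
      ae_eq_zero_of_eq_const hwP hP hφC, hvol] with x hx1 hx2 hx3 hx4 hx5
    by_cases hxC : x ∈ C
    · rw [hx3 hxC, hx4 hxC, hφC x hxC, hx5 hxC]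
      ring
    · have e1 : g x = deriv φ x := hx1.unique (hd0 x hxC)
      have h2 := (((hd0 x hxC).sub_const c).const_mul 2).fun_mul (hd1 x hxC)
      have e2 := hx2.unique (h2.congr_of_eventuallyEq (by
        filter_upwards [hU.mem_nhds hxC] with y hy using hPU y hy))
      rw [e1, e2]
      linear_combination -hode x hxC
  refine ⟨hφ, a, g, hg2, hg, fun ψ hψ => ?_⟩
  have e1 : ∫ x, (g x ^ 2 + 2 * φ x ^ 3 - 2 * c * φ x) * ψ x =
      ∫ x, (h x * ψ x + a * ψ x) :=
    integral_congr_ae (by filter_upwards [hmain] with x hx; rw [hx, add_mul])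
  rw [e1, integral_add (hph.locallyIntegrable_right.integrable_mul_isTestFunction hψ)
    (hψ.integrable.const_mul a), integral_const_mul, hwp.integral_eq _ hψ.deriv,
    hph.integral_eq ψ hψ, neg_neg]

theorem isTravelingWave_of_tw {c : ℝ} {φ : ℝ → ℝ} (hφ : MemH1Loc φ) (hcont : Continuous φ)
    {E : ℕ → Set ℝ} {C : Set ℝ} (h1 : TW1 c φ E C) (h2 : TW2 c φ E C) (h3 : TW3 c φ) :
    IsTravelingWave c φ := by
  obtain ⟨a, hode, ha⟩ := h2
  have hsmooth : ContDiffOn ℝ ∞ φ Cᶜ := by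
    rw [h1.compl_eq]
    intro x hx
    obtain ⟨i, hi⟩ := mem_iUnion.1 hx
    exact ((h1.smooth i).contDiffAt ((h1.isOpen i).mem_nhds hi)).contDiffWithinAt
  -- A constant satisfies the first-order equation for every `a` with a suitable `d`, so the given
  -- `a` may be the wrong one. The endpoint condition then forces the interval to be the whole line,
  -- and `a` can be replaced by 2v³ - 2cv.
  by_cases hconst : ∃ i, ∃ v, (E i).Nonempty ∧ ∀ x ∈ E i, φ x = v
  · obtain ⟨i, v, hne, hv⟩ := hconst
    have hvc : v ≠ c := by
      obtain ⟨x, hx⟩ := hne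
      exact hv x hx ▸ h1.ne_on x (mem_iUnion.2 ⟨i, hx⟩)
    have hfr : frontier (E i) = ∅ := by
      by_contra hcon
      obtain ⟨x, hx⟩ := nonempty_iff_ne_empty.2 hcon
      obtain ⟨d, -, hlim⟩ := hode i
      have : (𝓝[E i] x).NeBot := mem_closure_iff_nhdsWithin_neBot.1 hx.1
      have hl : Tendsto φ (𝓝[E i] x) (𝓝 v) :=
        tendsto_const_nhds.congr' (by
          filter_upwards [self_mem_nhdsWithin] with y hy using (hv y hy).symm)
      exact hvc (tendsto_nhds_unique hl (hlim x hx))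
    have huniv : E i = univ := (isClopen_iff_frontier_eq_empty.2 hfr).eq_univ hne
    have hφv : φ = fun _ => v := funext fun x => hv x (huniv ▸ mem_univ x)
    have hC0 : C = ∅ := by
      rw [← compl_univ_iff, h1.compl_eq, eq_univ_iff_forall]
      exact fun x => mem_iUnion.2 ⟨i, huniv ▸ mem_univ x⟩
    refine isTravelingWave_of_second_order (a := 2 * v ^ 3 - 2 * c * v) hφ hcont h1.isClosed
      h1.eq_on hsmooth (fun x _ => ?_) (fun h => ?_) h3
    · rw [hφv]
      simp
    · simp [hC0] at h
  · push Not at hconst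
    refine isTravelingWave_of_second_order (a := a) hφ hcont h1.isClosed h1.eq_on hsmooth
      (fun x hx => ?_) ha h3
    rw [h1.compl_eq] at hx
    obtain ⟨i, hi⟩ := mem_iUnion.1 hx
    obtain ⟨d, hd, -⟩ := hode i
    rcases second_order_or_const (h1.isOpen i) (h1.interval i) (h1.smooth i)
      (fun y hy => h1.ne_on y (mem_iUnion.2 ⟨i, hy⟩)) hd with h | ⟨v, hv⟩
    · exact h x hi
    · obtain ⟨y, hy, hyv⟩ := hconst i v ⟨x, hi⟩
      exact absurd (hv y hy) hyv

theorem tw_of_isTravelingWave {c : ℝ} {φ : ℝ → ℝ} (hcont : Continuous φ)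
    (htw : IsTravelingWave c φ) :
    (∃ (E : ℕ → Set ℝ) (C : Set ℝ), TW1 c φ E C ∧ TW2 c φ E C) ∧ TW3 c φ := by
  obtain ⟨-, a, g, hg2, hg, hid⟩ := htw
  have hgp := hg.isPrimitive hcont
  have hw := hgp.sq_sub_const c
  let p : ℝ → ℝ := fun x => 2 * (φ x - c) * g x
  let h : ℝ → ℝ := fun x => (g x ^ 2 + 2 * φ x ^ 3 - 2 * c * φ x) - a
  have hpoly : Continuous fun x => 2 * φ x ^ 3 := continuous_const.mul (hcont.pow 3)
  have hlin : Continuous fun x => 2 * c * φ x := continuous_const.mul hcont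
  have hl : LocallyIntegrable (fun x => g x ^ 2 + 2 * φ x ^ 3 - 2 * c * φ x) volume :=
    (hg2.locallyIntegrable_sq.add hpoly.locallyIntegrable).sub hlin.locallyIntegrable
  have hph : HasWeakDeriv p h := by
    refine ⟨hw.locallyIntegrable, hl.sub (locallyIntegrable_const a), fun ψ hψ => ?_⟩
    have e1 : ∫ x, h x * ψ x = ∫ x, (φ x - c) ^ 2 * deriv (deriv ψ) x := by
      simp only [h, sub_mul _ a]
      rw [integral_sub (hl.integrable_mul_isTestFunction hψ) (hψ.integrable.const_mul a),
        integral_const_mul, hid ψ hψ, add_sub_cancel_right]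
    rw [e1, hw.hasWeakDeriv.integral_eq _ hψ.deriv, neg_neg]
  obtain ⟨P, hpP, hP⟩ := hph.exists_isPrimitive
  let C : Set ℝ := {x | φ x = c}
  have hC : IsClosed C := isClosed_eq hcont continuous_const
  have hU : IsOpen Cᶜ := hC.isOpen_compl
  have hne : ∀ x ∈ Cᶜ, φ x ≠ c := fun x hx => hx
  -- This formula for φ' has a continuous right-hand side off C, which turns the a.e. derivatives of
  -- φ and P into classical ones.
  have hgQ : ∀ᵐ x, x ∈ Cᶜ → g x = P x / (2 * (φ x - c)) := by
    filter_upwards [hpP] with x hx hxC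
    rw [← hx, eq_div_iff (mul_ne_zero two_ne_zero (sub_ne_zero.2 (hne x hxC)))]
    ring
  have hQc : ContinuousOn (fun x => P x / (2 * (φ x - c))) Cᶜ :=
    hP.continuous.continuousOn.div
      (continuous_const.mul (hcont.sub continuous_const)).continuousOn
      fun x hx => mul_ne_zero two_ne_zero (sub_ne_zero.2 (hne x hx))
  have hφd : ∀ x ∈ Cᶜ, HasDerivAt φ (P x / (2 * (φ x - c))) x := fun x hx =>
    hgp.hasDerivAt_of_ae_eq hU hQc hgQ hx
  have hPd : ∀ x ∈ Cᶜ,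
      HasDerivAt P ((P x / (2 * (φ x - c))) ^ 2 + 2 * φ x ^ 3 - 2 * c * φ x - a) x :=
    fun x hx => hP.hasDerivAt_of_ae_eq hU
      (k := fun x => (P x / (2 * (φ x - c))) ^ 2 + 2 * φ x ^ 3 - 2 * c * φ x - a)
      ((((hQc.pow 2).add hpoly.continuousOn).sub hlin.continuousOn).sub continuousOn_const)
      (by filter_upwards [hgQ] with y hy hyC; simp only [h, hy hyC]) hx
  obtain ⟨E, hEo, hEc, hEd, hEU⟩ := exists_disjoint_intervals hU
  have hsub : ∀ i, E i ⊆ Cᶜ := fun i => hEU ▸ subset_iUnion E i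
  refine ⟨⟨E, C, ⟨hEo, hEc, hEd, hC, hEU, fun i => ?_, fun x hx => hne x (hEU ▸ hx),
    fun x hx => hx⟩, a, fun i => ?_, fun hpos => ?_⟩, p, h, hw.hasWeakDeriv, hph⟩
  · exact (contDiffOn_of_system hU hne hφd hPd).mono (hsub i)
  · obtain ⟨d, hd⟩ := exists_first_integral (hEo i) (hEc i) (fun x hx => hne x (hsub i hx))
      (fun x hx => hφd x (hsub i hx)) (fun x hx => hPd x (hsub i hx))
    refine ⟨d, hd, fun x hx => ?_⟩
    have hxC : φ x = c := frontier_subset_of_compl_eq_iUnion hEo hEd hEU i hx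
    exact hxC ▸ hcont.continuousAt.continuousWithinAt
  · by_contra hane
    refine hpos.ne' (measure_eq_zero_iff_ae_notMem.2 ?_)
    filter_upwards [hgp.ae_eq_zero_of_eqOn_const (C := C) fun x hx => hx,
      ae_eq_zero_of_eq_const (hw.congr_right hpP) hP (C := C) fun x hx => hx] with x hx1 hx2 hxC
    have e := hx2 hxC
    simp only [h, hx1 hxC, (show φ x = c from hxC)] at e
    exact hane (by linear_combination -e)

end MCH

theorem mainTheorem4 (c : ℝ) (φ : ℝ → ℝ) (hφ : MCH.MemH1Loc φ) (hcont : Continuous φ) :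
    MCH.IsTravelingWave c φ ↔
      (∃ (E : ℕ → Set ℝ) (C : Set ℝ), MCH.TW1 c φ E C ∧ MCH.TW2 c φ E C) ∧ MCH.TW3 c φ :=
  ⟨MCH.tw_of_isTravelingWave hcont, fun ⟨⟨_, _, h1, h2⟩, h3⟩ =>
    MCH.isTravelingWave_of_tw hφ hcont h1 h2 h3⟩
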